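/- Let $n\ge 1$, let $[n]=\{1,\dots,n\}$, and let $\mathfrak D_n$ be the set of derangements of $[n]$, i.e. permutations $\pi$ of $[n]$ with $\pi(i)\neq i$ for all $i$. For a permutation $\pi$ of $[n]$ put \begin{align*} \mathrm{EXCi}(\pi)&=\{j\in[n]:\pi(j)>j\}, & \mathrm{EXCv}(\pi)&=\{\pi(j): j\in \mathrm{EXCi}(\pi)\},\\ \mathrm{RLMi}(\pi)&=\{i\in[n]:\pi(i)<\pi(j)\text{ for all } j\in\{i+1,\dots,n\}\}, & \mathrm{RLMv}(\pi)&=\{\pi(i): i\in \mathrm{RLMi}(\pi)\}, \end{align*} and $\mathrm{inv}(\pi)=|\{(i,j):1\le i<j\le n,\ \pi(i)>\pi(j)\}|$. For commuting variables $x_1,\dots,x_n,y_1,\dots,y_n$ and $S\subseteq[n]$ write $\mathbf x_S=\prod_{s\in S}x_s$ and $\mathbf y_S=\prod_{s\in S}y_s$ (with empty products equal to $1$). Then $$\sum_{\pi\in\mathfrak D_n}(-1)^{\mathrm{inv}(\pi)}\,\mathbf x_{\mathrm{RLMv}(\pi)}\,\mathbf y_{\mathrm{EXCv}(\pi)}=(-1)^{n-1}\sum_{j=1}^{n-1}x_1\cdots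 x_j\cdot y_{j+1}\cdots y_n,$$ and moreover $$\sum_{\pi\in\mathfrak D_n}(-1)^{\mathrm{inv}(\pi)}\,\mathbf x_{\mathrm{RLMi}(\pi)}\,\mathbf y_{\mathrm{EXCi}(\pi)}=(-1)^{n-1}\sum_{j=1}^{n-1}y_1\cdots y_j\cdot x_{j+1}\cdots x_n.$$ Both are polynomial identities, valid over every commutative ring. -/

import Mathlib

open Finset

/-! The set `[n] = {1, …, n}` is modelled by `Fin n`: the element `i : Fin n` stands for the
integer `i + 1`. -/

namespace PermStat

variable {n : ℕ}

/-- The set of excedances (indices `j` with `g j > j`) of a function `g : [n] → [n]`. -/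
def EXCi (g : Fin n → Fin n) : Finset (Fin n) := univ.filter fun j => j < g j

/-- The set of excedance values of `g`. -/
def EXCv (g : Fin n → Fin n) : Finset (Fin n) := (EXCi g).image g

/-- The set of right-to-left minima indices of `g`. -/
def RLMi (g : Fin n → Fin n) : Finset (Fin n) := univ.filter fun i => ∀ j, i < j → g i < g j

/-- The set of right-to-left minima values of `g`. -/
def RLMv (g : Fin n → Fin n) : Finset (Fin n) := (RLMi g).image g

/-- The number of inversions of `g`. -/
def inv (g : Fin n → Fin n) : ℕ :=
  (univ.filter fun p : Fin n × Fin n => p.1 < p.2 ∧ g p.2 < g p.1).card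

/-- The product `x_S` of the variables `x_s`, `s ∈ S`, for `S ⊆ [n]`; the sequence `x` is
indexed by integers, and `s : Fin n` stands for the integer `s + 1`. -/
def monom {R : Type*} [CommRing R] (x : ℕ → R) (S : Finset (Fin n)) : R :=
  ∏ s ∈ S, x ((s : ℕ) + 1)

end PermStat

namespace PermStat

open Equiv

/-! ### Signs, swaps, cuts and right-to-left minima -/

section General

variable {n : ℕ} {R : Type*} [CommRing R]

/-! Two sign-reversing involutions, each swapping the values at two positions, cancel all but `n -
1` derangements.

Swapping the values of two overlapping excedance arcs keeps EXCv. It also keeps RLMv, since the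
right-to-left minima of a derangement depend only on its values below the diagonal (`RLMi_eq`). This
cancels every derangement with a crossing. Without crossings, each cut is passed downwards at most
once, so RLMv is the complement of EXCv (`Noncrossing.RLMv_eq`). Then only the sign and EXCv matter,
and swapping positions `l`, `l + 1` cancels whenever `l` is an excedance value and `l + 1` is not.

In a survivor EXCv is a final segment, and its least element determines the permutation: a full
cycle, hence of sign `(-1)^(n-1)`. Reflection in the antidiagonal turns the identity for values into
the one for indices. -/

theorem neg_one_pow_inv (π : Perm (Fin n)) : (-1 : R) ^ inv π = ((Perm.sign π : ℤ) : R) := by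
  have h : (Perm.sign π : ℤ) = (-1) ^ inv π := by
    rw [Perm.sign_eq_prod_prod_Ioi]
    push_cast
    have h1 : inv π = ∑ i, #{j ∈ Ioi i | π j < π i} := by
      rw [inv, ← card_sigma]
      refine card_nbij' (fun p => ⟨p.1, p.2⟩) (fun p => (p.1, p.2)) ?_ ?_ ?_ ?_ <;>
        simp +contextual [Set.MapsTo, Set.LeftInvOn]
    rw [h1, ← prod_pow_eq_pow_sum]
    refine prod_congr rfl fun i _ => ?_
    rw [← prod_const, prod_filter]
    refine prod_congr rfl fun j hj => ?_
    have hne : π i ≠ π j := fun h => (mem_Ioi.1 hj).ne (π.injective h)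
    rcases lt_or_gt_of_ne hne with h | h
    · simp [h, h.not_gt]
    · simp [h, h.not_gt]
  rw [h]
  push_cast
  rfl

/-- A sum over permutations that have a distinguished transposition vanishes, if multiplication by
that transposition keeps it distinguished and changes the sign of the summand. -/
theorem sum_eq_zero_of_swap (P : Perm (Fin n) → Fin n → Fin n → Prop) (w : Perm (Fin n) → R)
    (uniq : ∀ π i j i' j', P π i j → P π i' j' → i = i' ∧ j = j')
    (hne : ∀ π i j, P π i j → i ≠ j)
    (hswap : ∀ π i j, P π i j → P (π * swap i j) i j)
    (hw : ∀ π i j, P π i j → w (π * swap i j) = - w π)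
    (s : Finset (Perm (Fin n))) (hs : ∀ π, π ∈ s ↔ ∃ i j, P π i j) :
    ∑ π ∈ s, w π = 0 := by
  choose a b hab using fun π (hπ : π ∈ s) => (hs π).1 hπ
  refine sum_involution (fun π hπ => π * swap (a π hπ) (b π hπ)) ?_ ?_ ?_ ?_
  · intro π hπ
    rw [hw _ _ _ (hab π hπ), add_neg_cancel]
  · intro π hπ _ h
    exact hne _ _ _ (hab π hπ) (swap_eq_one_iff.1 (mul_eq_left.1 h))
  · intro π hπ
    exact (hs _).2 ⟨_, _, hswap _ _ _ (hab π hπ)⟩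
  · intro π hπ
    have h' := hswap _ _ _ (hab π hπ)
    -- By uniqueness the pair chosen for the image is the original one, so the map is an involution.
    obtain ⟨h1, h2⟩ := uniq _ _ _ _ _ (hab _ ((hs _).2 ⟨_, _, h'⟩)) h'
    simp only [h1, h2]
    rw [mul_assoc, swap_mul_self, mul_one]

theorem sign_mul_swap (π : Perm (Fin n)) {i j : Fin n} (h : i ≠ j) :
    ((Perm.sign (π * swap i j) : ℤ) : R) = -((Perm.sign π : ℤ) : R) := by
  rw [Perm.sign_mul, Perm.sign_swap h]
  simp

theorem mul_swap_apply_of_ne (π : Perm (Fin n)) {i j k : Fin n} (hi : k ≠ i) (hj : k ≠ j) :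
    (π * swap i j) k = π k := by
  simp [swap_apply_of_ne_of_ne hi hj]

theorem mul_swap_apply_left (π : Perm (Fin n)) (i j : Fin n) : (π * swap i j) i = π j := by simp

theorem mul_swap_apply_right (π : Perm (Fin n)) (i j : Fin n) : (π * swap i j) j = π i := by simp

theorem mem_EXCv {g : Fin n → Fin n} {v : Fin n} : v ∈ EXCv g ↔ ∃ a, a < v ∧ g a = v := by
  simp only [EXCv, EXCi, mem_image, mem_filter, mem_univ, true_and]
  constructor
  · rintro ⟨a, h, rfl⟩
    exact ⟨a, h, rfl⟩
  · rintro ⟨a, h, rfl⟩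
    exact ⟨a, h, rfl⟩

theorem EXCv_mul_swap (π : Perm (Fin n)) (i j : Fin n) (h1 : i < π i ↔ j < π i)
    (h2 : j < π j ↔ i < π j) : EXCv (π * swap i j : Perm (Fin n)) = EXCv π := by
  have key : ∀ π : Perm (Fin n), (i < π i ↔ j < π i) → (j < π j ↔ i < π j) →
      EXCv π ⊆ EXCv (π * swap i j : Perm (Fin n)) := by
    intro π h1 h2 v hv
    rw [mem_EXCv] at hv ⊢
    obtain ⟨a, ha, rfl⟩ := hv
    refine ⟨swap i j a, ?_, by simp⟩
    by_cases hi : a = i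
    · subst hi; simpa using h1.1 ha
    by_cases hj : a = j
    · subst hj; simpa using h2.1 ha
    · rwa [swap_apply_of_ne_of_ne hi hj]
  refine (subset_antisymm (key π h1 h2) ?_).symm
  have h := key (π * swap i j) (by simpa using h2.symm) (by simpa using h1.symm)
  rwa [mul_assoc, swap_mul_self, mul_one] at h

/-- As many points cross a cut upwards as downwards. -/
theorem card_cross (π : Perm (Fin n)) (m : ℕ) :
    #{p : Fin n | (p : ℕ) < m ∧ m ≤ (π p : ℕ)} = #{p : Fin n | m ≤ (p : ℕ) ∧ (π p : ℕ) < m} := by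
  have h : #{p : Fin n | (p : ℕ) < m} = #{p : Fin n | (π p : ℕ) < m} :=
    (card_equiv π (by simp)).symm
  have h1 := card_filter_add_card_filter_not (s := ({p : Fin n | (p : ℕ) < m} : Finset _))
    (fun p => (π p : ℕ) < m)
  have h2 := card_filter_add_card_filter_not (s := ({p : Fin n | (π p : ℕ) < m} : Finset _))
    (fun p => (p : ℕ) < m)
  simp only [filter_filter, not_lt] at h1 h2
  have h3 : #{p : Fin n | (π p : ℕ) < m ∧ (p : ℕ) < m} =
      #{p : Fin n | (p : ℕ) < m ∧ (π p : ℕ) < m} := by simp only [and_comm]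
  have h4 : #{p : Fin n | m ≤ (p : ℕ) ∧ (π p : ℕ) < m} =
      #{p : Fin n | (π p : ℕ) < m ∧ m ≤ (p : ℕ)} := by simp only [and_comm]
  omega

/-- An excedance is not a right-to-left minimum. -/
theorem exists_gt_lt_of_lt (π : Perm (Fin n)) {k : Fin n} (hk : k < π k) :
    ∃ l, k < l ∧ π l < π k := by
  have h := card_cross π (k + 1)
  have : 0 < #{p : Fin n | (p : ℕ) < k + 1 ∧ (k : ℕ) + 1 ≤ (π p : ℕ)} :=
    card_pos.2 ⟨k, by simp; omega⟩
  rw [h] at this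
  obtain ⟨l, hl⟩ := card_pos.1 this
  simp only [mem_filter, mem_univ, true_and] at hl
  exact ⟨l, by omega, by omega⟩

/-- A later excedance `l` is no obstruction when `π k < k`, as `π k < k < l < π l`. -/
theorem RLMi_eq {π : Perm (Fin n)} (hD : ∀ i, π i ≠ i) :
    RLMi π = ({k | π k < k ∧ ∀ l, k < l → π l < l → π k < π l} : Finset (Fin n)) := by
  ext k
  simp only [RLMi, mem_filter, mem_univ, true_and]
  constructor
  · refine fun h => ⟨?_, fun l hl _ => h l hl⟩
    by_contra hk
    have hk : k < π k := lt_of_le_of_ne (not_lt.1 hk) (hD k).symm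
    obtain ⟨l, hl, hl'⟩ := exists_gt_lt_of_lt π hk
    exact (h l hl).not_gt hl'
  · rintro ⟨h, h'⟩ l hl
    rcases lt_or_gt_of_ne (hD l) with h1 | h1
    · exact h' l hl h1
    · omega

end General

/-! ### Cancelling crossings -/

section Noncrossing

variable {n : ℕ} {R : Type*} [CommRing R] {π : Perm (Fin n)}

/-- The excedances `i` and `j` of `π`, with `i < j`, are both passed by the same cut. -/
def Crossing (π : Perm (Fin n)) (i j : Fin n) : Prop := i < j ∧ j < π i ∧ j < π j

/-- No two excedance arcs overlap. -/
def Noncrossing (π : Perm (Fin n)) : Prop := ∀ i j, ¬ Crossing π i j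

theorem Noncrossing.eq_of_cut (h : Noncrossing π) {p q : Fin n} {m : ℕ} (hp : (p : ℕ) < m)
    (hp' : m ≤ (π p : ℕ)) (hq : (q : ℕ) < m) (hq' : m ≤ (π q : ℕ)) : p = q := by
  by_contra hne
  rcases lt_or_gt_of_ne hne with hlt | hlt
  · exact h p q ⟨hlt, by omega, by omega⟩
  · exact h q p ⟨hlt, by omega, by omega⟩

theorem Noncrossing.eq_of_cut_down (h : Noncrossing π) {p q : Fin n} {m : ℕ} (hp : m ≤ (p : ℕ))
    (hp' : (π p : ℕ) < m) (hq : m ≤ (q : ℕ)) (hq' : (π q : ℕ) < m) : p = q := by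
  have h1 : #{p : Fin n | (p : ℕ) < m ∧ m ≤ (π p : ℕ)} ≤ 1 := by
    refine card_le_one.2 fun a ha b hb => ?_
    simp only [mem_filter, mem_univ, true_and] at ha hb
    exact h.eq_of_cut ha.1 ha.2 hb.1 hb.2
  rw [card_cross] at h1
  exact card_le_one.1 h1 p (by simp [hp, hp']) q (by simp [hq, hq'])

/-- An inversion between two non-excedances `k < l` would send both arcs down through the cut just
above `π k`. -/
theorem Noncrossing.RLMi_eq (h : Noncrossing π) (hD : ∀ i, π i ≠ i) : RLMi π = (EXCi π)ᶜ := by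
  rw [PermStat.RLMi_eq hD]
  ext k
  simp only [EXCi, mem_filter, mem_univ, true_and, mem_compl, not_lt]
  refine ⟨fun h => h.1.le, fun hk => ⟨lt_of_le_of_ne hk (hD k), fun l hl hl' => ?_⟩⟩
  have hk := lt_of_le_of_ne hk (hD k)
  by_contra hlt
  have := h.eq_of_cut_down (p := k) (q := l) (m := π k + 1) (by omega) (by omega) (by omega)
    (by omega)
  omega

theorem Noncrossing.RLMv_eq (h : Noncrossing π) (hD : ∀ i, π i ≠ i) : RLMv π = (EXCv π)ᶜ := by
  rw [RLMv, EXCv, h.RLMi_eq hD, ← coe_inj]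
  push_cast
  exact Set.image_compl_eq π.bijective

/-- The signed monomial of a permutation. -/
def weight (x y : ℕ → R) (π : Perm (Fin n)) : R :=
  (-1 : R) ^ inv π * monom x (RLMv π) * monom y (EXCv π)

theorem weight_mul_swap (x y : ℕ → R) {i j : Fin n} (hij : i ≠ j)
    (h1 : RLMv (π * swap i j : Perm (Fin n)) = RLMv π)
    (h2 : EXCv (π * swap i j : Perm (Fin n)) = EXCv π) :
    weight x y (π * swap i j) = - weight x y π := by
  simp only [weight, h1, h2, neg_one_pow_inv, sign_mul_swap π hij]
  ring

theorem Crossing.deranged_mul_swap {i j : Fin n} (h : Crossing π i j) (hD : ∀ i, π i ≠ i) (k) :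
    (π * swap i j) k ≠ k := by
  obtain ⟨h1, h2, h3⟩ := h
  by_cases hi : k = i
  · subst hi; rw [mul_swap_apply_left]; omega
  by_cases hj : k = j
  · subst hj; rw [mul_swap_apply_right]; omega
  rw [mul_swap_apply_of_ne π hi hj]
  exact hD k

theorem Crossing.EXCv_mul_swap {i j : Fin n} (h : Crossing π i j) :
    EXCv (π * swap i j : Perm (Fin n)) = EXCv π := by
  obtain ⟨h1, h2, h3⟩ := h
  exact PermStat.EXCv_mul_swap π i j (by omega) (by omega)

theorem Crossing.RLMv_mul_swap {i j : Fin n} (h : Crossing π i j) (hD : ∀ i, π i ≠ i) :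
    RLMv (π * swap i j : Perm (Fin n)) = RLMv π := by
  have hk : ∀ k, (π * swap i j) k < k ↔ π k < k := by
    intro k
    obtain ⟨h1, h2, h3⟩ := h
    by_cases hi : k = i
    · subst hi; rw [mul_swap_apply_left]; omega
    by_cases hj : k = j
    · subst hj; rw [mul_swap_apply_right]; omega
    rw [mul_swap_apply_of_ne π hi hj]
  have hk' : ∀ k, π k < k → (π * swap i j) k = π k := by
    intro k hlt
    obtain ⟨h1, h2, h3⟩ := h
    refine mul_swap_apply_of_ne π ?_ ?_ <;> rintro rfl <;> omega
  rw [RLMv, RLMv, RLMi_eq hD, RLMi_eq (h.deranged_mul_swap hD)]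
  have hset : ({k | (π * swap i j) k < k ∧ ∀ l, k < l → (π * swap i j) l < l →
      (π * swap i j) k < (π * swap i j) l} : Finset (Fin n)) =
      ({k | π k < k ∧ ∀ l, k < l → π l < l → π k < π l} : Finset (Fin n)) := by
    ext k
    simp only [mem_filter, mem_univ, true_and, hk]
    refine and_congr_right fun h1 => forall_congr' fun l => imp_congr_right fun _ =>
      imp_congr_right fun h2 => ?_
    rw [hk' k h1, hk' l h2]
  rw [hset]
  exact image_congr fun k hkm => hk' k (by simpa using (mem_filter.1 hkm).2.1)

theorem Crossing.mul_swap {i j : Fin n} (h : Crossing π i j) : Crossing (π * swap i j) i j := by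
  rw [Crossing, mul_swap_apply_left, mul_swap_apply_right]
  exact ⟨h.1, h.2.2, h.2.1⟩

/-- Below `j` only the value at `i` changes, and `π i` already exceeds `j`. Hence minimality of `j`
survives the swap. -/
theorem Crossing.of_mul_swap {i j i' j' : Fin n} (h : Crossing π i j) (hlt : j' < j)
    (h' : Crossing (π * swap i j) i' j') : Crossing π i' j' := by
  have key : ∀ k, k < j → j' < (π * swap i j) k → j' < π k := by
    intro k hk hk'
    by_cases hi : k = i
    · subst hi; exact hlt.trans h.2.1
    · rwa [mul_swap_apply_of_ne π hi hk.ne] at hk'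
  exact ⟨h'.1, key i' (h'.1.trans hlt) h'.2.1, key j' hlt h'.2.2⟩

/-- The permutations with a crossing contribute nothing. -/
theorem sum_weight_crossing (x y : ℕ → R) (s : Finset (Perm (Fin n)))
    (hs : ∀ π, π ∈ s ↔ (∀ i, π i ≠ i) ∧ ¬ Noncrossing π) : ∑ π ∈ s, weight x y π = 0 := by
  refine sum_eq_zero_of_swap
    (fun π i j => (∀ i, π i ≠ i) ∧ Crossing π i j ∧ ∀ i' j', j' < j → ¬ Crossing π i' j')
    _ ?_ ?_ ?_ ?_ s ?_
  · rintro π i j i' j' ⟨-, h1, h2⟩ ⟨-, h1', h2'⟩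
    have hj : j = j' := by
      rcases lt_trichotomy j j' with h | h | h
      · exact absurd h1 (h2' _ _ h)
      · exact h
      · exact absurd h1' (h2 _ _ h)
    subst hj
    refine ⟨?_, rfl⟩
    rcases lt_trichotomy i i' with h | h | h
    -- Two partners `i < i'` of the same `j` would cross each other, with `i' < j` against
    -- minimality.
    · exact absurd ⟨h, h1'.1.trans h1.2.1, h1'.1.trans h1'.2.1⟩ (h2 i i' h1'.1)
    · exact h
    · exact absurd ⟨h, h1.1.trans h1'.2.1, h1.1.trans h1.2.1⟩ (h2 i' i h1.1)
  · rintro π i j ⟨-, h, -⟩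
    exact h.1.ne
  · rintro π i j ⟨hD, h, h2⟩
    exact ⟨h.deranged_mul_swap hD, h.mul_swap, fun i' j' hlt h' => h2 i' j' hlt (h.of_mul_swap hlt h')⟩
  · rintro π i j ⟨hD, h, -⟩
    exact weight_mul_swap x y h.1.ne (h.RLMv_mul_swap hD) h.EXCv_mul_swap
  · intro π
    rw [hs]
    constructor
    · rintro ⟨hD, h⟩
      simp only [Noncrossing, not_forall, not_not] at h
      obtain ⟨i, j, hij⟩ := h
      have hex : ∃ j, ∃ i, Crossing π i j := ⟨j, i, hij⟩
      obtain ⟨j, ⟨i, hi⟩, hmin⟩ := WellFounded.has_min (wellFounded_lt (α := Fin n))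
        {j | ∃ i, Crossing π i j} hex
      exact ⟨i, j, hD, hi, fun i' j' hlt h' => hmin j' ⟨i', h'⟩ hlt⟩
    · rintro ⟨i, j, hD, h, -⟩
      exact ⟨hD, fun hN => hN i j h⟩

end Noncrossing

end PermStat

namespace PermStat

open Equiv

/-! ### Cancelling descents of excedance values -/

section Descent

variable {n : ℕ} {R : Type*} [CommRing R] {π : Perm (Fin n)}

/-- The value `l` is an excedance value and the next value `m` is not. -/
def ExcDescent (π : Perm (Fin n)) (l m : Fin n) : Prop :=
  (m : ℕ) = l + 1 ∧ l ∈ EXCv π ∧ m ∉ EXCv π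

/-- The arc ending at `l` fills the cut below `l`, so no other arc from below can pass over `l`. The
swap at `l`, `m` exchanges the two alternatives. -/
theorem ExcDescent.cases {l m : Fin n} (h : ExcDescent π l m) (hN : Noncrossing π)
    (hD : ∀ i, π i ≠ i) :
    (m < π l ∧ π m < l) ∨ (π l < l ∧ m < π m ∧ ∀ i, i < l → π i ≤ l) := by
  obtain ⟨hm, hl, hm'⟩ := h
  rw [mem_EXCv] at hl hm'
  push Not at hm'
  obtain ⟨a, ha, ha'⟩ := hl
  have hla : ∀ k, π k = l → k = a := fun k hk => π.injective (hk.trans ha'.symm)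
  have hno : ∀ i, i < l → π i ≤ l := by
    intro i hi
    by_contra hlt
    have := hN.eq_of_cut (p := i) (q := a) (m := l) (by omega) (by omega) (by omega) (by omega)
    subst this
    omega
  rcases lt_or_gt_of_ne (hD l) with h1 | h1
  · refine Or.inr ⟨h1, ?_, hno⟩
    by_contra hlt
    -- A descent at `m` forces some arc up through the cut between `l` and `m`, but none is
    -- available.
    have hpos : 0 < #{p : Fin n | (m : ℕ) ≤ (p : ℕ) ∧ (π p : ℕ) < m} := by
      refine card_pos.2 ⟨m, ?_⟩
      have := hD m
      simp only [mem_filter, mem_univ, true_and]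
      omega
    rw [← card_cross] at hpos
    obtain ⟨p, hp⟩ := card_pos.1 hpos
    simp only [mem_filter, mem_univ, true_and] at hp
    by_cases hpl : p = l
    · subst hpl; omega
    · have := hno p (by omega)
      omega
  · have h2 : π l ≠ m := hm' l (by omega)
    have h3 := hN l m
    have h4 := hD m
    have h5 : π m ≠ l := fun h => by have := hla m h; omega
    refine Or.inl ⟨by omega, ?_⟩
    by_contra hlt
    exact h3 ⟨by omega, by omega, by omega⟩

theorem ExcDescent.deranged_mul_swap {l m : Fin n} (h : ExcDescent π l m) (hN : Noncrossing π)
    (hD : ∀ i, π i ≠ i) (k : Fin n) : (π * swap l m) k ≠ k := by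
  have hm := h.1
  by_cases hi : k = l
  · subst hi; rw [mul_swap_apply_left]
    rcases h.cases hN hD with h | h <;> omega
  by_cases hj : k = m
  · subst hj; rw [mul_swap_apply_right]
    rcases h.cases hN hD with h | h <;> omega
  rw [mul_swap_apply_of_ne π hi hj]
  exact hD k

theorem ExcDescent.EXCv_mul_swap {l m : Fin n} (h : ExcDescent π l m) (hN : Noncrossing π)
    (hD : ∀ i, π i ≠ i) : EXCv (π * swap l m : Perm (Fin n)) = EXCv π := by
  have hm := h.1
  refine PermStat.EXCv_mul_swap π l m ?_ ?_ <;> rcases h.cases hN hD with h | h <;> omega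

theorem ExcDescent.noncrossing_mul_swap {l m : Fin n} (h : ExcDescent π l m)
    (hN : Noncrossing π) (hD : ∀ i, π i ≠ i) : Noncrossing (π * swap l m) := by
  have hm := h.1
  rintro i j ⟨h1, h2, h3⟩
  have hlm : l ≠ m := by omega
  rcases h.cases hN hD with ⟨h4, h5⟩ | ⟨h4, h5, h6⟩
  · have hil : i ≠ l := by
      rintro rfl; rw [mul_swap_apply_left] at h2; omega
    have hjl : j ≠ l := by
      rintro rfl; rw [mul_swap_apply_left] at h3; omega
    by_cases him : i = m
    · subst him
      rw [mul_swap_apply_right] at h2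
      rw [mul_swap_apply_of_ne π hjl h1.ne'] at h3
      exact hN l j ⟨by omega, h2, h3⟩
    rw [mul_swap_apply_of_ne π hil him] at h2
    by_cases hjm : j = m
    · subst hjm
      exact hN i l ⟨by omega, by omega, by omega⟩
    rw [mul_swap_apply_of_ne π hjl hjm] at h3
    exact hN i j ⟨h1, h2, h3⟩
  · have him : i ≠ m := by
      rintro rfl; rw [mul_swap_apply_right] at h2; omega
    have hjm : j ≠ m := by
      rintro rfl; rw [mul_swap_apply_right] at h3; omega
    by_cases hil : i = l
    · subst hil
      rw [mul_swap_apply_left] at h2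
      rw [mul_swap_apply_of_ne π h1.ne' hjm] at h3
      exact hN m j ⟨by omega, h2, h3⟩
    rw [mul_swap_apply_of_ne π hil him] at h2
    by_cases hjl : j = l
    · subst hjl
      have := h6 i h1
      omega
    rw [mul_swap_apply_of_ne π hjl hjm] at h3
    exact hN i j ⟨h1, h2, h3⟩

/-- The noncrossing derangements with a descent of excedance values contribute nothing. -/
theorem sum_weight_excDescent (x y : ℕ → R) (s : Finset (Perm (Fin n)))
    (hs : ∀ π, π ∈ s ↔ (∀ i, π i ≠ i) ∧ Noncrossing π ∧ ∃ l m, ExcDescent π l m) :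
    ∑ π ∈ s, weight x y π = 0 := by
  refine sum_eq_zero_of_swap
    (fun π l m => (∀ i, π i ≠ i) ∧ Noncrossing π ∧ ExcDescent π l m ∧
      ∀ l' m', l' < l → ¬ ExcDescent π l' m') _ ?_ ?_ ?_ ?_ s ?_
  · rintro π i j i' j' ⟨-, -, h1, h2⟩ ⟨-, -, h1', h2'⟩
    have hi : i = i' := by
      rcases lt_trichotomy i i' with h | h | h
      · exact absurd h1 (h2' _ _ h)
      · exact h
      · exact absurd h1' (h2 _ _ h)
    exact ⟨hi, Fin.ext (by rw [h1.1, h1'.1, hi])⟩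
  · rintro π i j ⟨-, -, h, -⟩ rfl
    have := h.1
    omega
  · rintro π i j ⟨hD, hN, h, h2⟩
    refine ⟨h.deranged_mul_swap hN hD, h.noncrossing_mul_swap hN hD, ?_, ?_⟩
    · simpa only [ExcDescent, h.EXCv_mul_swap hN hD] using h
    · simpa only [ExcDescent, h.EXCv_mul_swap hN hD] using h2
  · rintro π i j ⟨hD, hN, h, -⟩
    have hE := h.EXCv_mul_swap hN hD
    refine weight_mul_swap x y (fun hij => ?_) ?_ hE
    · have := h.1
      subst hij
      omega
    · rw [hN.RLMv_eq hD, (h.noncrossing_mul_swap hN hD).RLMv_eq (h.deranged_mul_swap hN hD), hE]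
  · intro π
    rw [hs]
    constructor
    · rintro ⟨hD, hN, l, m, h⟩
      obtain ⟨l, ⟨m, hm⟩, hmin⟩ := WellFounded.has_min (wellFounded_lt (α := Fin n))
        {l | ∃ m, ExcDescent π l m} ⟨l, m, h⟩
      exact ⟨l, m, hD, hN, hm, fun i' j' hlt h' => hmin i' ⟨j', h'⟩ hlt⟩
    · rintro ⟨i, j, hD, hN, h, -⟩
      exact ⟨hD, hN, i, j, h⟩

/-- Derangements without crossings and without descents of excedance values. -/
def IsExtremal (π : Perm (Fin n)) : Prop :=
  (∀ i, π i ≠ i) ∧ Noncrossing π ∧ ∀ l m, ¬ ExcDescent π l m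

open Classical in
theorem sum_weight_eq_sum_extremal (x y : ℕ → R) :
    ∑ π : Perm (Fin n) with ∀ i, π i ≠ i, weight x y π =
      ∑ π : Perm (Fin n) with IsExtremal π, weight x y π := by
  rw [← sum_filter_add_sum_filter_not _ (fun π => ¬ Noncrossing π),
    sum_weight_crossing x y _ (by simp), zero_add,
    ← sum_filter_add_sum_filter_not _ (fun π => ∃ l m, ExcDescent π l m),
    sum_weight_excDescent x y _ (by simp [and_assoc]), zero_add]
  refine sum_congr ?_ fun _ _ => rfl
  ext π
  simp only [mem_filter, mem_univ, true_and, not_not, not_exists, and_assoc]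
  rfl

end Descent

end PermStat

namespace PermStat

open Equiv

/-! ### Survivors are unimodal cycles -/

section Extremal

variable {k : ℕ} {R : Type*} [CommRing R] {π : Perm (Fin (k + 1))}

/-- The values of the cycle `0 → j → j + 1 → ⋯ → k → j - 1 → ⋯ → 1 → 0`. -/
def IsUnimodalCycle (j : ℕ) (π : Perm (Fin (k + 1))) : Prop :=
  ∀ i : Fin (k + 1), (π i : ℕ) =
    if (i : ℕ) = 0 then j else if (i : ℕ) < j then i - 1 else if (i : ℕ) < k then i + 1 else j - 1

theorem IsUnimodalCycle.eq {j : ℕ} {σ : Perm (Fin (k + 1))} (h : IsUnimodalCycle j π)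
    (h' : IsUnimodalCycle j σ) : π = σ :=
  Equiv.ext fun i => Fin.ext ((h i).trans (h' i).symm)

theorem IsUnimodalCycle.deranged {j : ℕ} (h : IsUnimodalCycle j π) (hj : 0 < j) (hjk : j ≤ k)
    (i) : π i ≠ i := by
  intro hi
  have := h i
  rw [hi] at this
  split_ifs at this <;> omega

theorem IsUnimodalCycle.noncrossing {j : ℕ} (h : IsUnimodalCycle j π) :
    Noncrossing π := by
  rintro a b ⟨h1, h2, h3⟩
  have ha := h a
  have hb := h b
  split_ifs at ha hb <;> omega

theorem IsUnimodalCycle.mem_EXCv {j : ℕ} (h : IsUnimodalCycle j π) (hj : 0 < j)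
    (v : Fin (k + 1)) : v ∈ EXCv π ↔ j ≤ v := by
  rw [PermStat.mem_EXCv]
  constructor
  · rintro ⟨a, ha, rfl⟩
    have := h a
    split_ifs at this <;> omega
  · intro hv
    obtain ⟨a, rfl⟩ := π.surjective v
    refine ⟨a, ?_, rfl⟩
    have := h a
    split_ifs at this <;> omega

theorem IsUnimodalCycle.isExtremal {j : ℕ} (h : IsUnimodalCycle j π) (hj : 0 < j) (hjk : j ≤ k) :
    IsExtremal π := by
  refine ⟨h.deranged hj hjk, h.noncrossing, ?_⟩
  rintro l m ⟨h1, h2, h3⟩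
  rw [h.mem_EXCv hj] at h2 h3
  omega

/-- A smaller excedance value would end an arc lying under `0 → π 0`, a crossing; upwards from `π
0`, absence of descents propagates membership. -/
theorem IsExtremal.mem_EXCv_iff (h : IsExtremal π) (v : Fin (k + 1)) : v ∈ EXCv π ↔ π 0 ≤ v := by
  obtain ⟨hD, hN, hE⟩ := h
  have h0 : (0 : Fin (k + 1)) < π 0 := Fin.pos_iff_ne_zero.2 (hD 0)
  constructor
  · intro hv
    rw [mem_EXCv] at hv
    obtain ⟨a, ha, rfl⟩ := hv
    by_contra hlt
    have ha0 : a ≠ 0 := by rintro rfl; exact hlt le_rfl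
    exact hN 0 a ⟨Fin.pos_iff_ne_zero.2 ha0, by omega, ha⟩
  · have key : ∀ v : ℕ, (π 0 : ℕ) ≤ v → ∀ hv : v < k + 1, (⟨v, hv⟩ : Fin (k + 1)) ∈ EXCv π := by
      intro v hv
      induction v, hv using Nat.le_induction with
      | base => exact fun _ => mem_EXCv.2 ⟨0, h0, rfl⟩
      | succ v hv ih =>
        intro hlt
        by_contra hcon
        exact hE _ _ ⟨rfl, ih (by omega), hcon⟩
    exact fun hv => key v hv v.2

theorem IsExtremal.isUnimodalCycle (h : IsExtremal π) : IsUnimodalCycle (π 0 : ℕ) π := by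
  have hmem := h.mem_EXCv_iff
  obtain ⟨hD, hN, -⟩ := h
  have h0 : (0 : Fin (k + 1)) < π 0 := Fin.pos_iff_ne_zero.2 (hD 0)
  have hexc : ∀ i, i < π i ↔ π 0 ≤ π i := by
    intro i
    rw [← hmem, mem_EXCv]
    exact ⟨fun h => ⟨i, h, rfl⟩, fun ⟨a, ha, ha'⟩ => π.injective ha' ▸ ha⟩
  have hlow : ∀ i : ℕ, ∀ hi : i < k + 1, 0 < i → i < (π 0 : ℕ) → (π ⟨i, hi⟩ : ℕ) = i - 1 := by
    intro i
    induction i using Nat.strong_induction_on with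
    | _ i ih =>
      intro hi hpos hlt
      have hanti : ¬ (⟨i, hi⟩ : Fin (k + 1)) < π ⟨i, hi⟩ := fun hh =>
        hN 0 ⟨i, hi⟩ ⟨Fin.lt_def.2 hpos, Fin.lt_def.2 hlt, hh⟩
      have hne := hD ⟨i, hi⟩
      have hle : (π ⟨i, hi⟩ : ℕ) < i := by
        rw [Fin.lt_def] at hanti
        rw [Ne, Fin.ext_iff] at hne
        dsimp only at hanti hne
        omega
      by_contra hcon
      -- A value below `i - 1` is already taken, by the position one above it.
      have h1 := ih ((π ⟨i, hi⟩ : ℕ) + 1) (by omega) (by omega) (by omega) (by omega)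
      have h2 := Fin.ext_iff.1 (π.injective (Fin.ext (by simpa using h1)))
      dsimp only at h2
      omega
  have hmid : ∀ i : Fin (k + 1), (π 0 : ℕ) ≤ i → ¬ i < π i → (π i : ℕ) = π 0 - 1 := by
    intro i hi hanti
    have h1 : ¬ π 0 ≤ π i := fun hh => hanti ((hexc i).2 hh)
    by_contra hcon
    have h2 := hlow ((π i : ℕ) + 1) (by omega) (by omega) (by omega)
    have h3 := Fin.ext_iff.1 (π.injective (Fin.ext (by simpa using h2)))
    dsimp only at h3
    omega
  have hlast : (π (Fin.last k) : ℕ) = π 0 - 1 :=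
    hmid _ (by simp; omega) (by simpa using Fin.le_last _)
  -- The one value `π 0 - 1` open to non-excedances here is used by the last position.
  have hexc' : ∀ i : Fin (k + 1), (π 0 : ℕ) ≤ i → (i : ℕ) < k → i < π i := by
    intro i hi hik
    by_contra hcon
    have h1 := π.injective (Fin.ext ((hmid i hi hcon).trans hlast.symm))
    subst h1
    simp at hik
  have hup : ∀ d : ℕ, ∀ i : Fin (k + 1), (π 0 : ℕ) ≤ i → (i : ℕ) < k → (i : ℕ) + d + 1 = k →
      (π i : ℕ) = i + 1 := by
    intro d
    induction d using Nat.strong_induction_on with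
    | _ d ih =>
      intro i hi hik hd
      have h1 := hexc' i hi hik
      by_contra hcon
      have h2 : (π i : ℕ) - 1 < k + 1 := by omega
      -- The induction runs down from position `k - 1`: a value above `i + 1` is already taken by
      -- the position just below it.
      have h3 := ih (k - π i) (by omega) ⟨(π i : ℕ) - 1, h2⟩ (by dsimp only; omega)
        (by dsimp only; omega) (by dsimp only; omega)
      have h4 := Fin.ext_iff.1 (π.injective (Fin.ext (h3.trans (by dsimp only; omega) :
        ((π ⟨(π i : ℕ) - 1, h2⟩ : Fin (k + 1)) : ℕ) = π i)))
      dsimp only at h4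
      omega
  intro i
  split_ifs with h1 h2 h3
  · congr 2
    exact Fin.ext h1
  · exact hlow i i.2 (by omega) h2
  · exact hup (k - i - 1) i (by omega) h3 (by omega)
  · have : i = Fin.last k := Fin.ext (by simp; omega)
    rw [this, hlast]

end Extremal

end PermStat

namespace PermStat

open Equiv

/-! ### Weights of the survivors -/

section Evaluation

variable {k : ℕ} {R : Type*} [CommRing R] {π : Perm (Fin (k + 1))}

/-- The permutation described by `IsUnimodalCycle j`. -/
def unimodalCycle (j : Fin (k + 1)) : Perm (Fin (k + 1)) :=
  (j.cycleRange * j.cycleRange)⁻¹ * finRotate (k + 1)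

theorem coe_cycleRange (j t : Fin (k + 1)) : (j.cycleRange t : ℕ) =
    if (t : ℕ) < j then (t : ℕ) + 1 else if (t : ℕ) = j then 0 else t := by
  split_ifs with h1 h2
  · exact Fin.coe_cycleRange_of_lt h1
  · rw [Fin.cycleRange_of_eq (Fin.ext h2)]; rfl
  · rw [Fin.cycleRange_of_gt]; omega

theorem isUnimodalCycle_unimodalCycle {j : Fin (k + 1)} (hj : 0 < (j : ℕ)) :
    IsUnimodalCycle j (unimodalCycle j) := by
  intro i
  obtain ⟨t, ht⟩ : ∃ t : Fin (k + 1), (t : ℕ) = if (i : ℕ) = 0 then (j : ℕ) else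
      if (i : ℕ) < j then i - 1 else if (i : ℕ) < k then i + 1 else j - 1 :=
    ⟨⟨if (i : ℕ) = 0 then (j : ℕ) else if (i : ℕ) < j then i - 1 else
      if (i : ℕ) < k then i + 1 else j - 1, by split_ifs <;> omega⟩, rfl⟩
  rw [← ht]
  congr 1
  rw [unimodalCycle, Perm.mul_apply, Perm.inv_eq_iff_eq, Perm.mul_apply]
  refine Fin.ext ?_
  rw [coe_finRotate, coe_cycleRange, coe_cycleRange]
  simp only [Fin.ext_iff, Fin.val_last]
  split_ifs at ht ⊢ <;> omega

/-- The square of `j.cycleRange` is even, so only `finRotate` contributes. -/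
theorem sign_unimodalCycle (j : Fin (k + 1)) : Perm.sign (unimodalCycle j) = (-1) ^ k := by
  rw [unimodalCycle, Perm.sign_mul, Perm.sign_inv, Perm.sign_mul, Int.units_mul_self, one_mul,
    sign_finRotate, Nat.add_sub_cancel]

theorem weight_unimodalCycle (x y : ℕ → R) {j : Fin (k + 1)} (hj : 0 < (j : ℕ)) :
    weight x y (unimodalCycle j) = (-1) ^ k *
      ((∏ i ∈ Icc 1 (j : ℕ), x i) * ∏ i ∈ Icc ((j : ℕ) + 1) (k + 1), y i) := by
  have h := isUnimodalCycle_unimodalCycle hj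
  have hext := h.isExtremal hj (by omega)
  have hE := h.mem_EXCv hj
  rw [weight, hext.2.1.RLMv_eq hext.1, neg_one_pow_inv, sign_unimodalCycle, mul_assoc]
  congr 1
  · simp
  congr 1
  · refine prod_bij (fun s _ => (s : ℕ) + 1) ?_ ?_ ?_ (fun _ _ => rfl)
    · intro s hs
      rw [mem_compl, hE] at hs
      rw [mem_Icc]; omega
    · intro s _ t _ hst
      omega
    · intro b hb
      rw [mem_Icc] at hb
      exact ⟨⟨b - 1, by omega⟩, by rw [mem_compl, hE]; dsimp only; omega, by dsimp only; omega⟩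
  · refine prod_bij (fun s _ => (s : ℕ) + 1) ?_ ?_ ?_ (fun _ _ => rfl)
    · intro s hs
      rw [hE] at hs
      rw [mem_Icc]; omega
    · intro s _ t _ hst
      omega
    · intro b hb
      rw [mem_Icc] at hb
      exact ⟨⟨b - 1, by omega⟩, by rw [hE]; dsimp only; omega, by dsimp only; omega⟩

theorem sum_weight_succ (x y : ℕ → R) :
    ∑ π : Perm (Fin (k + 1)) with ∀ i, π i ≠ i, weight x y π = (-1) ^ k *
      ∑ j ∈ Icc 1 k, (∏ i ∈ Icc 1 j, x i) * ∏ i ∈ Icc (j + 1) (k + 1), y i := by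
  classical
  rw [sum_weight_eq_sum_extremal, mul_sum]
  have hcyc : ∀ π : Perm (Fin (k + 1)), IsExtremal π → 0 < (π 0 : ℕ) ∧ π = unimodalCycle (π 0) := by
    intro π h
    have h0 : 0 < (π 0 : ℕ) := Fin.lt_def.1 (Fin.pos_iff_ne_zero.2 (h.1 0))
    exact ⟨h0, h.isUnimodalCycle.eq (isUnimodalCycle_unimodalCycle h0)⟩
  refine sum_bij (fun π _ => (π 0 : ℕ)) ?_ ?_ ?_ ?_
  · intro π hπ
    have := hcyc π (mem_filter.1 hπ).2
    rw [mem_Icc]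
    omega
  · intro π hπ σ hσ h
    rw [(hcyc π (mem_filter.1 hπ).2).2, (hcyc σ (mem_filter.1 hσ).2).2, Fin.ext h]
  · intro j hj
    rw [mem_Icc] at hj
    have h := isUnimodalCycle_unimodalCycle (k := k) (j := ⟨j, by omega⟩) hj.1
    refine ⟨_, mem_filter.2 ⟨mem_univ _, h.isExtremal hj.1 hj.2⟩, ?_⟩
    have := h 0
    simpa using this
  · intro π hπ
    obtain ⟨h1, h2⟩ := hcyc π (mem_filter.1 hπ).2
    conv_lhs => rw [h2]
    exact weight_unimodalCycle x y h1

theorem sum_weight (x y : ℕ → R) {n : ℕ} (hn : 1 ≤ n) :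
    ∑ π : Perm (Fin n) with ∀ i, π i ≠ i, weight x y π = (-1) ^ (n - 1) *
      ∑ j ∈ Icc 1 (n - 1), (∏ i ∈ Icc 1 j, x i) * ∏ i ∈ Icc (j + 1) n, y i := by
  obtain ⟨k, rfl⟩ := Nat.exists_eq_add_of_le' hn
  exact sum_weight_succ x y

end Evaluation

/-! ### From values to indices -/

section Reflection

variable {n : ℕ} {R : Type*} [CommRing R]

/-- Reflection of the graph of a permutation in the antidiagonal. -/
def reflect (π : Perm (Fin n)) : Perm (Fin n) := Fin.revPerm * π⁻¹ * Fin.revPerm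

theorem reflect_apply (π : Perm (Fin n)) (i : Fin n) : reflect π i = (π.symm i.rev).rev := rfl

theorem reflect_reflect (π : Perm (Fin n)) : reflect (reflect π) = π := by
  ext i
  rw [reflect_apply, Fin.val_inj, Fin.rev_eq_iff, symm_apply_eq, reflect_apply]
  simp

theorem reflect_deranged (π : Perm (Fin n)) (hD : ∀ i, π i ≠ i) (i : Fin n) :
    reflect π i ≠ i := by
  rw [reflect_apply, Ne, Fin.rev_eq_iff, symm_apply_eq]
  exact fun h => hD _ h.symm

theorem sign_reflect (π : Perm (Fin n)) : Perm.sign (reflect π) = Perm.sign π := by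
  rw [reflect, Perm.sign_mul, Perm.sign_mul, Perm.sign_inv, mul_comm, ← mul_assoc,
    Int.units_mul_self, one_mul]

theorem mem_EXCi_reflect (π : Perm (Fin n)) (i : Fin n) :
    i ∈ EXCi (reflect π) ↔ i.rev ∈ EXCv π := by
  rw [mem_EXCv]
  simp only [EXCi, mem_filter, mem_univ, true_and]
  rw [reflect_apply]
  rw [Fin.lt_rev_iff]
  constructor
  · exact fun h => ⟨_, h, by simp⟩
  · rintro ⟨a, ha, ha'⟩
    rwa [← ha', symm_apply_apply, ha']

/-- Antidiagonal reflection preserves the relation "below and to the right" between points of the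
graph, and turns values into reversed indices. -/
theorem mem_RLMi_reflect (π : Perm (Fin n)) (i : Fin n) :
    i ∈ RLMi (reflect π) ↔ i.rev ∈ RLMv π := by
  simp only [RLMv, RLMi, mem_image, mem_filter, mem_univ, true_and]
  simp only [reflect_apply, Fin.rev_lt_rev]
  constructor
  · refine fun h => ⟨π.symm i.rev, fun q hq => ?_, by simp⟩
    by_contra hlt
    rw [apply_symm_apply, not_lt] at hlt
    rcases hlt.eq_or_lt with heq | hlt
    · rw [← heq, symm_apply_apply] at hq
      exact hq.false
    · have := h (π q).rev (by rwa [Fin.lt_rev_iff])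
      rw [Fin.rev_rev, symm_apply_apply] at this
      exact this.not_gt hq
  · rintro ⟨p, hp, hp'⟩ j hj
    rw [← hp', symm_apply_apply]
    by_contra hlt
    rw [not_lt] at hlt
    rcases hlt.eq_or_lt with heq | hlt
    · rw [eq_symm_apply, hp', Fin.rev_inj] at heq
      exact hj.ne heq
    · have := hp _ hlt
      rw [apply_symm_apply, hp', Fin.rev_lt_rev] at this
      exact this.not_gt hj

theorem monom_rev (x : ℕ → R) {S T : Finset (Fin n)} (h : ∀ i, i ∈ S ↔ i.rev ∈ T) :
    monom x S = monom (fun i => x (n + 1 - i)) T := by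
  refine prod_bij (fun i _ => i.rev) (fun i hi => (h i).1 hi) ?_ ?_ ?_
  · exact fun a _ b _ hab => Fin.rev_injective hab
  · exact fun b hb => ⟨b.rev, (h _).2 (by rwa [Fin.rev_rev]), Fin.rev_rev b⟩
  · intro i _
    rw [Fin.val_rev]
    congr 1
    omega

theorem weight_reflect (x y : ℕ → R) (π : Perm (Fin n)) :
    (-1 : R) ^ inv (reflect π) * monom x (RLMi (reflect π)) * monom y (EXCi (reflect π)) =
      weight (fun i => x (n + 1 - i)) (fun i => y (n + 1 - i)) π := by
  rw [weight, neg_one_pow_inv, neg_one_pow_inv, sign_reflect, monom_rev x (mem_RLMi_reflect π),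
    monom_rev y (mem_EXCi_reflect π)]

theorem prod_Icc_reflect (x : ℕ → R) {a b a' b' : ℕ} (hab : a + b' = n + 1) (hba : b + a' = n + 1) :
    ∏ i ∈ Icc a b, x (n + 1 - i) = ∏ i ∈ Icc a' b', x i := by
  refine prod_nbij' (fun i => n + 1 - i) (fun i => n + 1 - i) ?_ ?_ ?_ ?_ (fun _ _ => rfl) <;>
    intro i hi <;> simp only [mem_Icc] at hi ⊢ <;> omega

theorem sum_weight_indices (x y : ℕ → R) (hn : 1 ≤ n) :
    ∑ π : Perm (Fin n) with ∀ i, π i ≠ i,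
        (-1 : R) ^ inv π * monom x (RLMi π) * monom y (EXCi π) = (-1) ^ (n - 1) *
      ∑ j ∈ Icc 1 (n - 1), (∏ i ∈ Icc 1 j, y i) * ∏ i ∈ Icc (j + 1) n, x i := by
  trans ∑ π : Perm (Fin n) with ∀ i, π i ≠ i,
    weight (fun i => x (n + 1 - i)) (fun i => y (n + 1 - i)) π
  · refine sum_nbij' reflect reflect ?_ ?_ ?_ ?_ ?_
    · exact fun π hπ => mem_filter.2 ⟨mem_univ _, reflect_deranged π (mem_filter.1 hπ).2⟩
    · exact fun π hπ => mem_filter.2 ⟨mem_univ _, reflect_deranged π (mem_filter.1 hπ).2⟩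
    · exact fun π _ => reflect_reflect π
    · exact fun π _ => reflect_reflect π
    · intro π _
      rw [← weight_reflect, reflect_reflect]
  · rw [sum_weight _ _ hn]
    congr 1
    -- Reversing the variables moves the break between the two products from `j` to `n - j`.
    refine sum_nbij' (fun j => n - j) (fun j => n - j) ?_ ?_ ?_ ?_ ?_ <;> intro j hj <;>
      rw [mem_Icc] at hj
    · rw [mem_Icc]; omega
    · rw [mem_Icc]; omega
    · omega
    · omega
    · rw [mul_comm, prod_Icc_reflect y (a' := 1) (b' := n - j) (by omega) (by omega),
        prod_Icc_reflect x (a' := n - j + 1) (b' := n) (by omega) (by omega)]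

theorem sum_derangements (f : Perm (Fin n) → R) :
    ∑ π : derangements (Fin n), f π = ∑ π : Perm (Fin n) with ∀ i, π i ≠ i, f π :=
  (sum_subtype _ (by simp [derangements]) f).symm

end Reflection

end PermStat

theorem mainTheorem1 {R : Type*} [CommRing R] (x y : ℕ → R) (n : ℕ) (hn : 1 ≤ n) :
    (∑ π : derangements (Fin n),
        (-1 : R) ^ PermStat.inv (π : Equiv.Perm (Fin n)) *
          PermStat.monom x (PermStat.RLMv (π : Equiv.Perm (Fin n))) *
          PermStat.monom y (PermStat.EXCv (π : Equiv.Perm (Fin n)))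
      = (-1 : R) ^ (n - 1) *
          ∑ j ∈ Finset.Icc 1 (n - 1),
            (∏ i ∈ Finset.Icc 1 j, x i) * ∏ i ∈ Finset.Icc (j + 1) n, y i) ∧
    (∑ π : derangements (Fin n),
        (-1 : R) ^ PermStat.inv (π : Equiv.Perm (Fin n)) *
          PermStat.monom x (PermStat.RLMi (π : Equiv.Perm (Fin n))) *
          PermStat.monom y (PermStat.EXCi (π : Equiv.Perm (Fin n)))
      = (-1 : R) ^ (n - 1) *
          ∑ j ∈ Finset.Icc 1 (n - 1),
            (∏ i ∈ Finset.Icc 1 j, y i) * ∏ i ∈ Finset.Icc (j + 1) n, x i) :=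
  ⟨(PermStat.sum_derangements _).trans (PermStat.sum_weight x y hn),
    (PermStat.sum_derangements _).trans (PermStat.sum_weight_indices x y hn)⟩
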